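/- For a finite group $G$ let $\mu(G)$ be its minimal faithful permutation degree, the least integer $n\ge 0$ such that $G$ embeds in $\mathrm{Sym}(n)$. Let $\mathcal T$ be the binary tetrahedral group, i.e. the group of the $24$ unit quaternions $\pm1,\pm i,\pm j,\pm k,\tfrac12(\pm1\pm i\pm j\pm k)$, and let $\mathcal T\circ\mathcal T$ be its central product with itself, the quotient of $\mathcal T\times\mathcal T$ by $\{(z,z): z\in Z(\mathcal T)\}$. Let $W(F_4)$ be the Coxeter group of type $F_4$, with simple generators $s_1,s_2,s_3,s_4$ numbered along the diagram. Then $$\mu(\mathcal T\circ\mathcal T)=\mu(W(F_4))=24.$$ Moreover: (i) $\mathcal T\circ\mathcal T$ has a unique minimal normal subgroup, and this subgroup is cyclic of order $2$; every faithful permutation representation of $\mathcal T\circ\mathcal T$ of degree $\mu(\mathcal T\circ\mathcal T)$ is transitive; and every subgroup $L$ of $\mathcal T\circ\mathcal T$ with trivial core $\bigcap_{g}g^{-1}Lg$ has index at least $24$. (ii) Let $\Phi\subset\mathbb R^4$ be the root system of type $F_4$, consisting of the long roots $\pm e_i\pm e_j$ ($i<j$), of squared length $2$, and the short roots $\pm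 e_i$ and $\tfrac12(\pm e_1\pm e_2\pm e_3\pm e_4)$, of squared length $1$. There is a homomorphism $W(F_4)\to O_4(\mathbb R)$ that sends $s_1,s_2,s_3,s_4$ to the reflections in the hyperplanes orthogonal to the simple roots $e_2-e_3,\ e_3-e_4,\ e_4,\ \tfrac12(e_1-e_2-e_3-e_4)$. For each of the two lengths, $\Phi$ has exactly $24$ roots of that length, and $W(F_4)$, acting through this homomorphism, maps this set of $24$ roots to itself and acts faithfully on it. -/

import Mathlib

open scoped Quaternion

noncomputable section

/-- The minimal faithful permutation degree `μ(G)`: the least `n` such that `G` embeds in `Sym(n)`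
(the value for a group with no such embedding is irrelevant). -/
def minFaithfulDegree (G : Type*) [Group G] : ℕ :=
  sInf {n : ℕ | ∃ f : G →* Equiv.Perm (Fin n), Function.Injective f}

/-- `N` is a minimal normal subgroup: it is minimal among the non-trivial normal subgroups. -/
def IsMinimalNormal {G : Type*} [Group G] (N : Subgroup G) : Prop :=
  Minimal (fun M : Subgroup G => M.Normal ∧ M ≠ ⊥) N

/-- The diagonal subgroup `{(z, z) | z ∈ Z(G)}` of the centre of `G × G`. -/
def centralDiagonal (G : Type*) [Group G] : Subgroup (G × G) :=
  (Subgroup.center G).map ((MonoidHom.id G).prod (MonoidHom.id G))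

instance centralDiagonal_normal (G : Type*) [Group G] : (centralDiagonal G).Normal where
  conj_mem := by
    rintro _ ⟨z, hz, rfl⟩ ⟨g, h⟩
    refine ⟨z, hz, ?_⟩
    have hz' := Subgroup.mem_center_iff.mp hz
    ext
    · simp [hz' g]
    · simp [hz' h]

/-- The central product `G ∘ G` of a group with itself. -/
abbrev CentralSquare (G : Type*) [Group G] : Type _ := (G × G) ⧸ centralDiagonal G

/-- The binary tetrahedral group, as a subgroup of the group `S³` of real unit quaternions
(`unitary ℍ[ℝ]`, the `q` with `star q * q = q * star q = 1`).  It consists of the 24 unit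
quaternions `±1, ±i, ±j, ±k, (±1 ± i ± j ± k) / 2`, i.e. of the unit quaternions whose
coordinates are all integers or all halves of odd integers. -/
def binaryTetrahedral : Subgroup (unitary ℍ[ℝ]) where
  carrier := {q | ∃ a b c d : ℤ, (2 ∣ b - a ∧ 2 ∣ c - a ∧ 2 ∣ d - a) ∧
    (q : ℍ[ℝ]).re = a / 2 ∧ (q : ℍ[ℝ]).imI = b / 2 ∧ (q : ℍ[ℝ]).imJ = c / 2 ∧
      (q : ℍ[ℝ]).imK = d / 2}
  one_mem' := ⟨2, 0, 0, 0, by decide, by simp⟩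
  mul_mem' := by
    rintro p q ⟨a, b, c, d, ⟨⟨b', hb⟩, ⟨c', hc⟩, ⟨d', hd⟩⟩, hp1, hp2, hp3, hp4⟩
      ⟨x, y, z, t, ⟨⟨y', hy⟩, ⟨z', hz⟩, ⟨t', ht⟩⟩, hq1, hq2, hq3, hq4⟩
    obtain rfl : b = a + 2 * b' := by omega
    obtain rfl : c = a + 2 * c' := by omega
    obtain rfl : d = a + 2 * d' := by omega
    obtain rfl : y = x + 2 * y' := by omega
    obtain rfl : z = x + 2 * z' := by omega
    obtain rfl : t = x + 2 * t' := by omega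
    refine ⟨-(a * x) - a * y' - b' * x - 2 * b' * y' - a * z' - c' * x - 2 * c' * z'
        - a * t' - d' * x - 2 * d' * t',
      a * x + a * y' + b' * x + a * t' + c' * x + 2 * c' * t' - a * z' - d' * x - 2 * d' * z',
      a * x + a * z' + c' * x + a * y' + d' * x + 2 * d' * y' - a * t' - b' * x - 2 * b' * t',
      a * x + a * t' + d' * x + a * z' + b' * x + 2 * b' * z' - a * y' - c' * x - 2 * c' * y',
      ⟨⟨a * x + a * y' + b' * x + b' * y' + a * t' + c' * x + c' * t' + c' * z' + d' * t'
          - d' * z', by ring⟩,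
       ⟨a * x + a * z' + c' * x + c' * z' + a * y' + d' * x + d' * y' + b' * y' + d' * t'
          - b' * t', by ring⟩,
       ⟨a * x + a * t' + d' * x + d' * t' + a * z' + b' * x + b' * z' + b' * y' + c' * z'
          - c' * y', by ring⟩⟩, ?_⟩
    rw [Submonoid.coe_mul, Quaternion.re_mul, Quaternion.imI_mul, Quaternion.imJ_mul,
      Quaternion.imK_mul, hp1, hp2, hp3, hp4, hq1, hq2, hq3, hq4]
    push_cast
    refine ⟨?_, ?_, ?_, ?_⟩ <;> ring
  inv_mem' := by
    rintro p ⟨a, b, c, d, ⟨hb, hc, hd⟩, h1, h2, h3, h4⟩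
    refine ⟨a, -b, -c, -d, by omega, ?_⟩
    rw [← Unitary.star_eq_inv, Unitary.coe_star, Quaternion.re_star, Quaternion.imI_star,
      Quaternion.imJ_star, Quaternion.imK_star, h1, h2, h3, h4]
    push_cast
    refine ⟨?_, ?_, ?_, ?_⟩ <;> ring

/-- The root system of type `F₄` in Euclidean 4-space: the vectors of squared length `1` or `2`
whose coordinates are all integers or all halves of odd integers.  These are the short roots
`±eᵢ` and `(±e₁ ± e₂ ± e₃ ± e₄) / 2`, and the long roots `±eᵢ ± eⱼ` (`i < j`). -/
def rootsF4 : Set (EuclideanSpace ℝ (Fin 4)) :=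
  {v | (‖v‖ ^ 2 = 1 ∨ ‖v‖ ^ 2 = 2) ∧
    ((∀ i, ∃ n : ℤ, v i = n) ∨ (∀ i, ∃ n : ℤ, v i = n + 1 / 2))}

/-- The roots of type `F₄` of squared length `l`. -/
def rootsF4OfSqLength (l : ℝ) : Set (EuclideanSpace ℝ (Fin 4)) :=
  {v | v ∈ rootsF4 ∧ ‖v‖ ^ 2 = l}

/-- The standard simple roots of type `F₄`, numbered along the Coxeter diagram. -/
def simpleRootF4 : Fin 4 → EuclideanSpace ℝ (Fin 4) :=
  ![!₂[0, 1, -1, 0], !₂[0, 0, 1, -1], !₂[0, 0, 0, 1], !₂[1 / 2, -1 / 2, -1 / 2, -1 / 2]]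

/-- The orthogonal reflection of Euclidean 4-space in the hyperplane perpendicular to `v`. -/
def rootReflection (v : EuclideanSpace ℝ (Fin 4)) :
    EuclideanSpace ℝ (Fin 4) ≃ₗᵢ[ℝ] EuclideanSpace ℝ (Fin 4) :=
  (Submodule.span ℝ {v})ᗮ.reflection

end

/-!
Write `T` for the binary tetrahedral group and `z` for the image of `(-1, 1)` in `T ∘ T`.

**The group `T ∘ T`.**  As `-1` is the only involution of `T`, a subgroup of `T` that avoids `-1`
has odd order, hence order `1` or `3`; and a subgroup normalizing one of order `3` has at most six
elements.  Let `H ≤ T × T` contain neither `(-1, 1)` nor `(1, -1)`.  If one of the two projections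
is injective on `H`, then `|H| ≤ 24`.  Otherwise both kernels have order `3`, and `|H| ≤ 6 * 3`
(`card_le_of_neg_one_notMem`).  Hence a subgroup of `T ∘ T` that avoids `z` has index at least `24`.
If such a subgroup is normal, it is trivial (`centralInvolution_mem_of_normal`), so that `⟨z⟩` is the
unique minimal normal subgroup.  In a faithful permutation representation some point is moved by
`z`; its stabilizer avoids `z`, and its orbit has at least `24` points.  Degree `24` is attained by
the left and right translations of `T`.

**The group `W(F₄)`.**  The simple reflections satisfy the Coxeter relations, which is a finite
computation with integral coordinates in the simple roots.  The resulting representation is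
faithful by the classical argument of Tits: if `sᵢ` is not a right descent of `w`, then `w αᵢ` is a
non-negative combination of simple roots (`reflectionRep_simpleRootF4_mem`).  This is proved by
induction on the length of `w`, by splitting off the longest possible alternating word in `sᵢ` and a
right descent `sⱼ` of `w`.  The roots of either length span the space, so `W(F₄)` acts faithfully on
each of the two sets of `24` roots, and `μ(W(F₄)) ≤ 24`.

For the converse, identify Euclidean 4-space with the quaternions.  Left and right multiplications
by elements of `T` are products of reflections in roots; this has to be checked for two generators
of `T` only (`quaternionPerm_generators_mem_range`).  Therefore `T ∘ T` embeds in `W(F₄)`, and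
`24 = μ(T ∘ T) ≤ μ(W(F₄))`.

Computations in `T` take place among the doubled Hurwitz quaternions, which have integral
coordinates.
-/

open scoped Quaternion

noncomputable section

/-! ### Doubled Hurwitz quaternions -/

instance : DecidableEq ℍ[ℤ] := fun a b =>
  decidable_of_iff (a.re = b.re ∧ a.imI = b.imI ∧ a.imJ = b.imJ ∧ a.imK = b.imK)
    Quaternion.ext_iff.symm

/-- The integral quaternion with coordinates `a, b, c, d`. -/
def intQuat (a b c d : ℤ) : ℍ[ℤ] := ⟨a, b, c, d⟩

@[simp] theorem intQuat_re (a b c d : ℤ) : (intQuat a b c d).re = a := rfl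
@[simp] theorem intQuat_imI (a b c d : ℤ) : (intQuat a b c d).imI = b := rfl
@[simp] theorem intQuat_imJ (a b c d : ℤ) : (intQuat a b c d).imJ = c := rfl
@[simp] theorem intQuat_imK (a b c d : ℤ) : (intQuat a b c d).imK = d := rfl

theorem exists_eq_intQuat (q : ℍ[ℤ]) : ∃ a b c d, q = intQuat a b c d :=
  ⟨q.re, q.imI, q.imJ, q.imK, rfl⟩

/-- The integral quaternions of norm `n` whose coordinates are congruent modulo `2`.  They are the
doubles of the Hurwitz quaternions of norm `n / 4`.  All coordinates are looked for in `[-2, 2]`,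
which loses nothing as long as `n ≤ 8`. -/
def doubledShell (n : ℤ) : Finset ℍ[ℤ] :=
  let s : Finset ℤ := {-2, -1, 0, 1, 2}
  ((s ×ˢ s ×ˢ s ×ˢ s).filter fun t =>
    (2 ∣ t.2.1 - t.1 ∧ 2 ∣ t.2.2.1 - t.1 ∧ 2 ∣ t.2.2.2 - t.1) ∧
      t.1 ^ 2 + t.2.1 ^ 2 + t.2.2.1 ^ 2 + t.2.2.2 ^ 2 = n).image
    fun t => intQuat t.1 t.2.1 t.2.2.1 t.2.2.2

theorem mem_doubledShell {n : ℤ} (hn : n ≤ 8) {q : ℍ[ℤ]} :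
    q ∈ doubledShell n ↔ (2 ∣ q.imI - q.re ∧ 2 ∣ q.imJ - q.re ∧ 2 ∣ q.imK - q.re) ∧
      q.re ^ 2 + q.imI ^ 2 + q.imJ ^ 2 + q.imK ^ 2 = n := by
  constructor
  · intro h
    obtain ⟨t, ht, rfl⟩ := Finset.mem_image.mp h
    exact (Finset.mem_filter.mp ht).2
  · intro h
    have key : ∀ a b c d : ℤ, a ^ 2 + b ^ 2 + c ^ 2 + d ^ 2 = n →
        a ∈ ({-2, -1, 0, 1, 2} : Finset ℤ) := by
      intro a b c d e
      have h1 : a < 3 := by nlinarith [sq_nonneg b, sq_nonneg c, sq_nonneg d]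
      have h2 : -3 < a := by nlinarith [sq_nonneg b, sq_nonneg c, sq_nonneg d]
      interval_cases a <;> decide
    refine Finset.mem_image.mpr ⟨(q.re, q.imI, q.imJ, q.imK), Finset.mem_filter.mpr ⟨?_, h⟩, rfl⟩
    simp only [Finset.mem_product]
    exact ⟨key _ _ _ _ h.2, key q.imI q.re q.imJ q.imK (by linarith [h.2]),
      key q.imJ q.re q.imI q.imK (by linarith [h.2]),
      key q.imK q.re q.imI q.imJ (by linarith [h.2])⟩

theorem card_doubledShell_four : (doubledShell 4).card = 24 := by decide +kernel

theorem card_doubledShell_eight : (doubledShell 8).card = 24 := by decide +kernel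

/-- Half of an integral quaternion, as a real quaternion. -/
def halve (q : ℍ[ℤ]) : ℍ[ℝ] := ⟨q.re / 2, q.imI / 2, q.imJ / 2, q.imK / 2⟩

@[simp] theorem halve_re (q : ℍ[ℤ]) : (halve q).re = q.re / 2 := rfl
@[simp] theorem halve_imI (q : ℍ[ℤ]) : (halve q).imI = q.imI / 2 := rfl
@[simp] theorem halve_imJ (q : ℍ[ℤ]) : (halve q).imJ = q.imJ / 2 := rfl
@[simp] theorem halve_imK (q : ℍ[ℤ]) : (halve q).imK = q.imK / 2 := rfl

theorem halve_injective : Function.Injective halve := by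
  intro p q h
  have h' := Quaternion.ext_iff.mp h
  simp only [halve_re, halve_imI, halve_imJ, halve_imK] at h'
  obtain ⟨h1, h2, h3, h4⟩ := h'
  ext <;> [have := h1; have := h2; have := h3; have := h4] <;>
  · have h5 := (div_left_inj' (two_ne_zero (α := ℝ))).mp this
    exact_mod_cast h5

theorem halve_mul (p q : ℍ[ℤ]) : halve (p * q) = 2 * (halve p * halve q) := by
  rw [two_mul]
  ext <;> simp <;> ring

theorem halve_star (q : ℍ[ℤ]) : halve (star q) = star (halve q) := by
  ext <;> simp [neg_div]

theorem norm_sq_halve (q : ℍ[ℤ]) :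
    ‖halve q‖ ^ 2 = ((q.re ^ 2 + q.imI ^ 2 + q.imJ ^ 2 + q.imK ^ 2 : ℤ) : ℝ) / 4 := by
  rw [sq, ← Quaternion.normSq_eq_norm_mul_self, Quaternion.normSq_def']
  simp only [halve_re, halve_imI, halve_imJ, halve_imK]
  push_cast
  ring

/-! ### The binary tetrahedral group -/

theorem norm_coe_unitary (g : unitary ℍ[ℝ]) : ‖(g : ℍ[ℝ])‖ ^ 2 = 1 := by
  rw [CStarRing.norm_coe_unitary, one_pow]

theorem exists_halve_of_mem_binaryTetrahedral {g : unitary ℍ[ℝ]} (hg : g ∈ binaryTetrahedral) :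
    ∃ q ∈ doubledShell 4, halve q = g := by
  obtain ⟨a, b, c, d, hd, h1, h2, h3, h4⟩ := hg
  have e : halve (intQuat a b c d) = g := by
    ext <;> [rw [h1]; rw [h2]; rw [h3]; rw [h4]] <;> rfl
  refine ⟨intQuat a b c d, (mem_doubledShell (by norm_num)).mpr ⟨hd, ?_⟩, e⟩
  have h := norm_sq_halve (intQuat a b c d)
  rw [e, norm_coe_unitary, eq_div_iff four_ne_zero, one_mul] at h
  exact_mod_cast h.symm

theorem halve_mem_unitary {q : ℍ[ℤ]} (hq : q ∈ doubledShell 4) : halve q ∈ unitary ℍ[ℝ] := by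
  have h := ((mem_doubledShell (by norm_num)).mp hq).2
  have h' : (q.re ^ 2 + q.imI ^ 2 + q.imJ ^ 2 + q.imK ^ 2 : ℝ) = 4 := by exact_mod_cast h
  have e : Quaternion.normSq (halve q) = 1 := by
    rw [Quaternion.normSq_def']
    simp only [halve_re, halve_imI, halve_imJ, halve_imK]
    linarith
  rw [Unitary.mem_iff, Quaternion.star_mul_self, Quaternion.self_mul_star, e]
  exact ⟨Quaternion.coe_one, Quaternion.coe_one⟩

/-- The element of the binary tetrahedral group with given doubled coordinates. -/
def ofDoubled (q : ℍ[ℤ]) (hq : q ∈ doubledShell 4) : binaryTetrahedral :=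
  ⟨⟨halve q, halve_mem_unitary hq⟩, q.re, q.imI, q.imJ, q.imK,
    ((mem_doubledShell (by norm_num)).mp hq).1, rfl, rfl, rfl, rfl⟩

theorem binaryTetrahedral_ext {g h : binaryTetrahedral}
    (e : ((g : unitary ℍ[ℝ]) : ℍ[ℝ]) = ((h : unitary ℍ[ℝ]) : ℍ[ℝ])) : g = h :=
  Subtype.ext (Subtype.ext e)

theorem exists_eq_ofDoubled (g : binaryTetrahedral) : ∃ q, ∃ hq : q ∈ doubledShell 4,
    g = ofDoubled q hq := by
  obtain ⟨q, hq, e⟩ := exists_halve_of_mem_binaryTetrahedral g.2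
  exact ⟨q, hq, binaryTetrahedral_ext e.symm⟩

theorem ofDoubled_bijective :
    Function.Bijective fun q : doubledShell 4 => ofDoubled q.1 q.2 := by
  refine ⟨fun p q h => Subtype.ext (halve_injective ?_), fun g => ?_⟩
  · exact congrArg (fun g : binaryTetrahedral => ((g : unitary ℍ[ℝ]) : ℍ[ℝ])) h
  · obtain ⟨q, hq, e⟩ := exists_eq_ofDoubled g
    exact ⟨⟨q, hq⟩, e.symm⟩

instance : Finite binaryTetrahedral :=
  Finite.of_surjective _ ofDoubled_bijective.2

theorem card_binaryTetrahedral : Nat.card binaryTetrahedral = 24 := by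
  rw [← Nat.card_eq_of_bijective _ ofDoubled_bijective, Nat.card_eq_fintype_card,
    Fintype.card_coe, card_doubledShell_four]

instance : HasDistribNeg binaryTetrahedral where
  neg g := ⟨-g, by
    obtain ⟨a, b, c, d, hd, h1, h2, h3, h4⟩ := g.2
    refine ⟨-a, -b, -c, -d, by omega, ?_⟩
    simp only [Unitary.coe_neg, Quaternion.re_neg, Quaternion.imI_neg, Quaternion.imJ_neg,
      Quaternion.imK_neg, h1, h2, h3, h4]
    push_cast
    refine ⟨?_, ?_, ?_, ?_⟩ <;> ring⟩
  neg_neg g := Subtype.ext (neg_neg _)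
  neg_mul g h := Subtype.ext (neg_mul _ _)
  mul_neg g h := Subtype.ext (mul_neg _ _)

theorem coe_neg_binaryTetrahedral (g : binaryTetrahedral) :
    (((-g : binaryTetrahedral) : unitary ℍ[ℝ]) : ℍ[ℝ]) = -((g : unitary ℍ[ℝ]) : ℍ[ℝ]) := rfl

theorem neg_one_ne_one_binaryTetrahedral : (-1 : binaryTetrahedral) ≠ 1 := by
  intro h
  have h' := congrArg (fun g : binaryTetrahedral => ((g : unitary ℍ[ℝ]) : ℍ[ℝ]).re) h
  simp only [coe_neg_binaryTetrahedral] at h'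
  norm_num at h'

/-- `-1` is the only involution, because the quaternions form a division ring. -/
theorem eq_neg_one_of_sq_eq_one {g : binaryTetrahedral} (h : g ^ 2 = 1) (hg : g ≠ 1) : g = -1 := by
  have h' : ((g : unitary ℍ[ℝ]) : ℍ[ℝ]) ^ 2 = 1 :=
    congrArg (fun g : binaryTetrahedral => ((g : unitary ℍ[ℝ]) : ℍ[ℝ])) h
  rcases sq_eq_one_iff.mp h' with h' | h'
  · exact absurd (binaryTetrahedral_ext h') hg
  · exact binaryTetrahedral_ext h'

/-! ### Subgroups of the binary tetrahedral group -/

/-- A subgroup avoiding `-1` has odd order, by Cauchy's theorem, and this order divides `24`. -/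
theorem card_dvd_three_of_neg_one_notMem {K : Subgroup binaryTetrahedral} (hK : -1 ∉ K) :
    Nat.card K ∣ 3 := by
  have h24 : Nat.card K ∣ 2 ^ 3 * 3 := by
    simpa [card_binaryTetrahedral] using K.card_subgroup_dvd_card
  refine Nat.Coprime.dvd_of_dvd_mul_left (Nat.Coprime.pow_right 3 ?_) h24
  rw [Nat.coprime_comm, Nat.Prime.coprime_iff_not_dvd Nat.prime_two]
  intro h2
  obtain ⟨x, hx⟩ := exists_prime_orderOf_dvd_card' 2 h2
  refine hK ?_
  rw [← eq_neg_one_of_sq_eq_one (g := x)]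
  · exact x.2
  · rw [← hx, ← Subgroup.orderOf_coe, pow_orderOf_eq_one]
  · rintro h
    rw [OneMemClass.coe_eq_one] at h
    rw [h, orderOf_one] at hx
    omega

/-- Real part `-1` singles out the doubles of the elements `k` of order three, for which
`star k = k⁻¹`; so the set counted here is the normalizer of `{1, k, k⁻¹}`. -/
theorem card_doubledShell_normalizer : ∀ k ∈ doubledShell 4, k.re = -1 →
    ((doubledShell 4).filter fun g => g * k = k * g ∨ g * k = star k * g).card ≤ 6 := by
  decide +kernel

/-- A quaternion `k ≠ 1` with `k ^ 3 = 1` has real part `-1/2`, as `k + k⁻¹ = k + k ^ 2 = -1`. -/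
theorem re_ofDoubled_eq_neg_one {q : ℍ[ℤ]} {hq : q ∈ doubledShell 4}
    (h3 : ofDoubled q hq ^ 3 = 1) (h1 : ofDoubled q hq ≠ 1) : q.re = -1 := by
  set k := ofDoubled q hq with hk
  have hu := (k : unitary ℍ[ℝ]).2
  have hc : ((k : unitary ℍ[ℝ]) : ℍ[ℝ]) = halve q := rfl
  have h3' : halve q ^ 3 = 1 := congrArg (fun g : binaryTetrahedral => ((g : unitary ℍ[ℝ]) : ℍ[ℝ])) h3
  have h1' : halve q - 1 ≠ 0 := fun h => h1 (binaryTetrahedral_ext (sub_eq_zero.mp h))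
  have hs : halve q * star (halve q) = 1 := (Unitary.mem_iff.mp hu).2
  have e : halve q ^ 2 + halve q + 1 = 0 := by
    refine (mul_eq_zero.mp (?_ : (halve q - 1) * (halve q ^ 2 + halve q + 1) = 0)).resolve_left h1'
    have : (halve q - 1) * (halve q ^ 2 + halve q + 1) = halve q ^ 3 - 1 := by noncomm_ring
    rw [this, h3', sub_self]
  have e' : halve q + 1 + star (halve q) = 0 := by
    have : (halve q ^ 2 + halve q + 1) * star (halve q) = 0 := by rw [e, zero_mul]
    rwa [add_mul, add_mul, sq, mul_assoc, hs, mul_one, one_mul] at this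
  have e'' := congrArg (fun x : ℍ[ℝ] => x.re) e'
  simp at e''
  have : (q.re : ℝ) = -1 := by linarith
  exact_mod_cast this

/-- The normalizer of a subgroup `{1, k, k⁻¹}` of order three has at most six elements. -/
theorem card_le_six_of_normalizes {k : binaryTetrahedral} (h3 : k ^ 3 = 1) (h1 : k ≠ 1)
    (P : Subgroup binaryTetrahedral) (hP : ∀ g ∈ P, g * k * g⁻¹ = k ∨ g * k * g⁻¹ = k⁻¹) :
    Nat.card P ≤ 6 := by
  obtain ⟨q, hq, rfl⟩ := exists_eq_ofDoubled k
  refine le_trans ?_ (card_doubledShell_normalizer q hq (re_ofDoubled_eq_neg_one h3 h1))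
  set F := (doubledShell 4).filter fun g => g * q = q * g ∨ g * q = star q * g
  have hmem : ∀ g : P, ∃ x : F, ∃ hx, (g : binaryTetrahedral) = ofDoubled x.1 hx := by
    intro g
    obtain ⟨x, hx, e⟩ := exists_eq_ofDoubled g
    refine ⟨⟨x, Finset.mem_filter.mpr ⟨hx, ?_⟩⟩, hx, e⟩
    rcases hP g g.2 with h | h <;> rw [mul_inv_eq_iff_eq_mul, e] at h
    · left
      apply halve_injective
      rw [halve_mul, halve_mul]
      exact congrArg (2 * ·) (congrArg (fun g : binaryTetrahedral => ((g : unitary ℍ[ℝ]) : ℍ[ℝ])) h)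
    · right
      apply halve_injective
      rw [halve_mul, halve_mul, halve_star]
      exact congrArg (2 * ·) (congrArg (fun g : binaryTetrahedral => ((g : unitary ℍ[ℝ]) : ℍ[ℝ])) h)
  choose φ hφ hφ' using hmem
  have hinj : Function.Injective φ := by
    intro a b h
    apply Subtype.ext
    rw [hφ', hφ']
    simp only [h]
  simpa using Nat.card_le_card_of_injective φ hinj

/-- A subgroup normalizing a subgroup of order three has at most six elements. -/
theorem card_le_six_of_card_eq_three {K : Subgroup binaryTetrahedral} (hK : Nat.card K = 3)
    (P : Subgroup binaryTetrahedral) (hP : ∀ g ∈ P, ∀ x ∈ K, g * x * g⁻¹ ∈ K) :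
    Nat.card P ≤ 6 := by
  classical
  obtain ⟨⟨k, hk⟩, hord⟩ := exists_prime_orderOf_dvd_card' 3 hK.symm.dvd
  rw [Subgroup.orderOf_mk] at hord
  have h3 : k ^ 3 = 1 := by rw [← hord, pow_orderOf_eq_one]
  have h1 : k ≠ 1 := by
    rintro rfl
    rw [orderOf_one] at hord
    omega
  refine card_le_six_of_normalizes h3 h1 P fun g hg => ?_
  have hz : Subgroup.zpowers k = K := by
    refine Subgroup.eq_of_le_of_card_ge (by simpa using hk) ?_
    rw [Nat.card_zpowers, hord, hK]
  have hx := hP g hg k hk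
  rw [← hz, mem_zpowers_iff_mem_range_orderOf, hord] at hx
  obtain ⟨n, hn, e⟩ := Finset.mem_image.mp hx
  rw [Finset.mem_range] at hn
  interval_cases n
  · rw [pow_zero, eq_comm, conj_eq_one_iff] at e
    exact absurd e h1
  · left
    rw [← e, pow_one]
  · right
    rw [← e, eq_inv_iff_mul_eq_one, ← pow_succ, h3]

/-- The order of a subgroup of a product, by projecting to the first factor. -/
theorem card_eq_card_map_fst_mul {A B : Type*} [Group A] [Group B] (H : Subgroup (A × B)) :
    Nat.card H = Nat.card (H.map (MonoidHom.fst A B)) * Nat.card (H.comap (MonoidHom.inr A B)) := by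
  have h := ((MonoidHom.fst A B).comp H.subtype).ker.card_mul_index
  rw [Subgroup.index_ker, MonoidHom.range_comp, Subgroup.range_subtype] at h
  rw [← h, mul_comm]
  congr 1
  refine Nat.card_congr ⟨fun x => ⟨x.1.1.2, ?_⟩, fun y => ⟨⟨(1, y.1), y.2⟩, rfl⟩, ?_, fun _ => rfl⟩
  · have h1 : x.1.1.1 = 1 := x.2
    have h2 := x.1.2
    rw [Subgroup.mem_comap, MonoidHom.inr_apply, ← h1]
    exact h2
  · rintro ⟨⟨⟨a, b⟩, h⟩, h'⟩
    obtain rfl : a = 1 := h'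
    rfl

theorem card_eq_card_map_snd_mul {A B : Type*} [Group A] [Group B] (H : Subgroup (A × B)) :
    Nat.card H = Nat.card (H.map (MonoidHom.snd A B)) * Nat.card (H.comap (MonoidHom.inl A B)) := by
  have h := ((MonoidHom.snd A B).comp H.subtype).ker.card_mul_index
  rw [Subgroup.index_ker, MonoidHom.range_comp, Subgroup.range_subtype] at h
  rw [← h, mul_comm]
  congr 1
  refine Nat.card_congr ⟨fun x => ⟨x.1.1.1, ?_⟩, fun y => ⟨⟨(y.1, 1), y.2⟩, rfl⟩, ?_, fun _ => rfl⟩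
  · have h1 : x.1.1.2 = 1 := x.2
    have h2 := x.1.2
    rw [Subgroup.mem_comap, MonoidHom.inl_apply, ← h1]
    exact h2
  · rintro ⟨⟨⟨a, b⟩, h⟩, h'⟩
    obtain rfl : b = 1 := h'
    rfl

/-- If both kernels are non-trivial, they have order three and are normalized by the projections,
so that `|H| ≤ 6 * 3`; otherwise one projection is injective on `H`. -/
theorem card_le_of_neg_one_notMem {H : Subgroup (binaryTetrahedral × binaryTetrahedral)}
    (h1 : (-1, 1) ∉ H) (h2 : (1, -1) ∉ H) : Nat.card H ≤ 24 := by
  have hK1 : Nat.card (H.comap (MonoidHom.inl _ _)) ∣ 3 := card_dvd_three_of_neg_one_notMem h1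
  have hK2 : Nat.card (H.comap (MonoidHom.inr _ _)) ∣ 3 := card_dvd_three_of_neg_one_notMem h2
  have hle (P : Subgroup binaryTetrahedral) : Nat.card P ≤ 24 :=
    card_binaryTetrahedral ▸ P.card_le_card_group
  rcases (Nat.dvd_prime Nat.prime_three).mp hK1 with hK1 | hK1
  · rw [card_eq_card_map_snd_mul, hK1, mul_one]
    exact hle _
  rcases (Nat.dvd_prime Nat.prime_three).mp hK2 with hK2 | hK2
  · rw [card_eq_card_map_fst_mul, hK2, mul_one]
    exact hle _
  rw [card_eq_card_map_fst_mul, hK2]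
  have := card_le_six_of_card_eq_three hK1 (H.map (MonoidHom.fst _ _)) (by
    rintro _ ⟨⟨a, b⟩, hab, rfl⟩ x hx
    have := H.mul_mem (H.mul_mem hab hx) (H.inv_mem hab)
    simpa using this)
  omega

/-! ### The central square of the binary tetrahedral group -/

theorem mem_centralDiagonal {G : Type*} [Group G] {x : G × G} :
    x ∈ centralDiagonal G ↔ x.1 ∈ Subgroup.center G ∧ x.1 = x.2 := by
  constructor
  · rintro ⟨z, hz, rfl⟩
    exact ⟨hz, rfl⟩
  · rintro ⟨h, e⟩
    exact ⟨x.1, h, Prod.ext rfl e⟩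

theorem neg_one_mem_center_binaryTetrahedral :
    (-1 : binaryTetrahedral) ∈ Subgroup.center binaryTetrahedral :=
  Subgroup.mem_center_iff.mpr fun g => by rw [mul_neg_one, neg_one_mul]

/-- The image of `(-1, 1)` in `T ∘ T`, which is also the image of `(1, -1)`. -/
def centralInvolution : CentralSquare binaryTetrahedral := QuotientGroup.mk (-1, 1)

theorem centralInvolution_ne_one : centralInvolution ≠ 1 := by
  intro h
  have h' := mem_centralDiagonal.mp ((QuotientGroup.eq_one_iff _).mp h)
  exact neg_one_ne_one_binaryTetrahedral h'.2

theorem orderOf_centralInvolution : orderOf centralInvolution = 2 := by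
  refine orderOf_eq_prime ?_ centralInvolution_ne_one
  rw [centralInvolution, ← QuotientGroup.mk_pow, Prod.pow_mk, neg_one_sq, one_pow]
  rfl

theorem centralInvolution_mem_center :
    centralInvolution ∈ Subgroup.center (CentralSquare binaryTetrahedral) := by
  refine Subgroup.mem_center_iff.mpr fun x => ?_
  obtain ⟨⟨g, h⟩, rfl⟩ := QuotientGroup.mk_surjective x
  simp [centralInvolution, ← QuotientGroup.mk_mul]

theorem mk_one_neg_one : (QuotientGroup.mk (1, -1) : CentralSquare binaryTetrahedral) =
    centralInvolution := by
  refine QuotientGroup.eq.mpr (mem_centralDiagonal.mpr ?_)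
  simpa using neg_one_mem_center_binaryTetrahedral

/-- The bound `|H| ≤ 24` applied to the preimage `H` of `L` in `T × T`, a group of order `24 ^ 2`. -/
theorem index_ge_of_centralInvolution_notMem {L : Subgroup (CentralSquare binaryTetrahedral)}
    (hL : centralInvolution ∉ L) : 24 ≤ L.index := by
  set π := QuotientGroup.mk' (centralDiagonal binaryTetrahedral)
  have hcard : Nat.card (L.comap π) ≤ 24 := by
    refine card_le_of_neg_one_notMem hL fun h => hL ?_
    rw [← mk_one_neg_one]
    exact h
  have h := (L.comap π).card_mul_index
  rw [Subgroup.index_comap_of_surjective L (QuotientGroup.mk'_surjective _), Nat.card_prod,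
    card_binaryTetrahedral] at h
  nlinarith

/-- Every non-trivial normal subgroup of `T ∘ T` contains the central involution: otherwise the
commutators of its preimage with the two factors vanish, as the binary tetrahedral group has no
normal subgroup of order three, so that this preimage is central. -/
theorem centralInvolution_mem_of_normal {M : Subgroup (CentralSquare binaryTetrahedral)}
    (hM : M.Normal) (hne : M ≠ ⊥) : centralInvolution ∈ M := by
  by_contra hz
  apply hne
  set H := M.comap (QuotientGroup.mk' (centralDiagonal binaryTetrahedral)) with hH
  have hHn : H.Normal := hM.comap _
  have triv (K : Subgroup binaryTetrahedral) (hK : -1 ∉ K) (hn : K.Normal) : K = ⊥ := by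
    rcases (Nat.dvd_prime Nat.prime_three).mp (card_dvd_three_of_neg_one_notMem hK) with h | h
    · exact Subgroup.eq_bot_of_card_eq K h
    · have := card_le_six_of_card_eq_three h ⊤ fun g _ x hx => hn.conj_mem x hx g
      rw [Subgroup.card_top, card_binaryTetrahedral] at this
      omega
  have h1 : H.comap (MonoidHom.inl _ _) = ⊥ := triv _ hz (hHn.comap _)
  have h2 : H.comap (MonoidHom.inr _ _) = ⊥ := by
    refine triv _ (fun h => hz ?_) (hHn.comap _)
    rw [← mk_one_neg_one]
    exact h
  have hcomm (x y) (hx : x ∈ H) : y * x * y⁻¹ * x⁻¹ ∈ H :=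
    H.mul_mem (hHn.conj_mem x hx y) (H.inv_mem hx)
  rw [eq_bot_iff]
  intro x hx
  obtain ⟨⟨g, h⟩, rfl⟩ := QuotientGroup.mk_surjective x
  have hgh : (g, h) ∈ H := hx
  -- `([t, g], 1)` and `(1, [t, h])` lie in `H`
  have hg : g ∈ Subgroup.center binaryTetrahedral := by
    refine Subgroup.mem_center_iff.mpr fun t => ?_
    have : t * g * t⁻¹ * g⁻¹ ∈ H.comap (MonoidHom.inl _ _) := by
      simpa using hcomm (g, h) (t, 1) hgh
    rw [h1, Subgroup.mem_bot, mul_inv_eq_one, mul_inv_eq_iff_eq_mul] at this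
    exact this
  have hh : h ∈ Subgroup.center binaryTetrahedral := by
    refine Subgroup.mem_center_iff.mpr fun t => ?_
    have : t * h * t⁻¹ * h⁻¹ ∈ H.comap (MonoidHom.inr _ _) := by
      simpa using hcomm (g, h) (1, t) hgh
    rw [h2, Subgroup.mem_bot, mul_inv_eq_one, mul_inv_eq_iff_eq_mul] at this
    exact this
  -- modulo the diagonal, `(g, h)` may be replaced by `(g * h⁻¹, 1)`
  have hd : (h⁻¹, h⁻¹) ∈ H := by
    have : (QuotientGroup.mk (h⁻¹, h⁻¹) : CentralSquare binaryTetrahedral) = 1 :=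
      (QuotientGroup.eq_one_iff _).mpr
        (mem_centralDiagonal.mpr ⟨(Subgroup.center _).inv_mem hh, rfl⟩)
    rw [hH, Subgroup.mem_comap, QuotientGroup.mk'_apply, this]
    exact M.one_mem
  have : g * h⁻¹ ∈ H.comap (MonoidHom.inl _ _) := by
    simpa using H.mul_mem hgh hd
  rw [h1, Subgroup.mem_bot, mul_inv_eq_one] at this
  exact (QuotientGroup.eq_one_iff _).mpr (mem_centralDiagonal.mpr ⟨hg, this⟩)

theorem isMinimalNormal_iff (M : Subgroup (CentralSquare binaryTetrahedral)) :
    IsMinimalNormal M ↔ M = Subgroup.zpowers centralInvolution := by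
  have hN : (Subgroup.zpowers centralInvolution).Normal := by
    refine ⟨fun x hx g => ?_⟩
    have hc : x ∈ Subgroup.center (CentralSquare binaryTetrahedral) :=
      (Subgroup.zpowers_le.mpr centralInvolution_mem_center) hx
    rwa [Subgroup.mem_center_iff.mp hc g, mul_inv_cancel_right]
  have hN' : Subgroup.zpowers centralInvolution ≠ ⊥ :=
    Subgroup.zpowers_ne_bot.mpr centralInvolution_ne_one
  constructor
  · rintro ⟨⟨h1, h2⟩, h3⟩
    have hle := Subgroup.zpowers_le.mpr (centralInvolution_mem_of_normal h1 h2)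
    exact le_antisymm (h3 ⟨hN, hN'⟩ hle) hle
  · rintro rfl
    exact ⟨⟨hN, hN'⟩, fun M hM _ =>
      Subgroup.zpowers_le.mpr (centralInvolution_mem_of_normal hM.1 hM.2)⟩

theorem index_ge_of_normalCore_eq_bot {L : Subgroup (CentralSquare binaryTetrahedral)}
    (hL : L.normalCore = ⊥) : 24 ≤ L.index := by
  refine index_ge_of_centralInvolution_notMem fun h => centralInvolution_ne_one ?_
  have : centralInvolution ∈ L.normalCore := fun g => by
    rwa [Subgroup.mem_center_iff.mp centralInvolution_mem_center g, mul_inv_cancel_right]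
  rwa [hL, Subgroup.mem_bot] at this

/-- A faithful permutation representation moves some point by the central involution; the
stabilizer of that point has index at least `24`. -/
theorem exists_orbit_ge {n : ℕ} {f : CentralSquare binaryTetrahedral →* Equiv.Perm (Fin n)}
    (hf : Function.Injective f) : ∃ x, 24 ≤ (Set.range fun g => f g x).ncard := by
  have h1 : f centralInvolution ≠ 1 := fun h =>
    centralInvolution_ne_one (hf (h.trans (map_one f).symm))
  obtain ⟨x, hx⟩ : ∃ x, f centralInvolution x ≠ x := by
    by_contra! h
    exact h1 (Equiv.ext h)
  let : MulAction (CentralSquare binaryTetrahedral) (Fin n) := MulAction.compHom _ f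
  refine ⟨x, ?_⟩
  have := index_ge_of_centralInvolution_notMem
    (L := MulAction.stabilizer (CentralSquare binaryTetrahedral) x) hx
  rwa [MulAction.index_stabilizer] at this

theorem le_of_injective_perm {n : ℕ} {f : CentralSquare binaryTetrahedral →* Equiv.Perm (Fin n)}
    (hf : Function.Injective f) : 24 ≤ n := by
  obtain ⟨x, hx⟩ := exists_orbit_ge hf
  refine hx.trans ((Set.ncard_le_card _).trans ?_)
  simp

theorem transitive_of_injective_perm
    {f : CentralSquare binaryTetrahedral →* Equiv.Perm (Fin 24)}
    (hf : Function.Injective f) (x y : Fin 24) : ∃ g, f g x = y := by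
  obtain ⟨z, hz⟩ := exists_orbit_ge hf
  have huniv : (Set.range fun g => f g z) = Set.univ :=
    Set.eq_of_subset_of_ncard_le (Set.subset_univ _) (by simpa using hz)
  obtain ⟨a, ha⟩ : x ∈ Set.range fun g => f g z := huniv ▸ Set.mem_univ x
  obtain ⟨b, hb⟩ : y ∈ Set.range fun g => f g z := huniv ▸ Set.mem_univ y
  refine ⟨b * a⁻¹, ?_⟩
  simp only at ha hb
  rw [map_mul, map_inv, Equiv.Perm.mul_apply, Equiv.Perm.inv_eq_iff_eq.mpr ha.symm, hb]

/-- The action of `G ∘ G` on a monoid `M` by left and right translations, where `G` is mapped to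
the units of `M` in such a way that the centre of `G` is central in `M`. -/
def CentralSquare.toPerm {G M : Type*} [Group G] [Monoid M] (φ : G →* Mˣ)
    (hc : ∀ z ∈ Subgroup.center G, ∀ x : M, φ z * x = x * φ z) :
    CentralSquare G →* Equiv.Perm M :=
  QuotientGroup.lift (centralDiagonal G)
    { toFun := fun x => (φ x.1).mulLeft.trans (φ x.2⁻¹).mulRight
      map_one' := by ext; simp
      map_mul' := fun x y => by ext; simp [mul_assoc] }
    (by
      intro x hx
      obtain ⟨hz, e⟩ := mem_centralDiagonal.mp hx
      rw [MonoidHom.mem_ker]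
      ext t
      simp [← e, hc _ hz t])

theorem CentralSquare.toPerm_injective {G M : Type*} [Group G] [Monoid M] {φ : G →* Mˣ}
    (hφ : Function.Injective φ) (hc : ∀ z ∈ Subgroup.center G, ∀ x : M, φ z * x = x * φ z) :
    Function.Injective (CentralSquare.toPerm φ hc) := by
  rw [injective_iff_map_eq_one]
  intro x hx
  obtain ⟨⟨g, h⟩, rfl⟩ := QuotientGroup.mk_surjective x
  have key (t : Mˣ) : φ g * t * φ h⁻¹ = t :=
    Units.ext (congrArg (fun e : Equiv.Perm M => e t) hx)
  have e : g = h := by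
    apply hφ
    simpa [mul_inv_eq_one] using key 1
  subst e
  refine (QuotientGroup.eq_one_iff _).mpr (mem_centralDiagonal.mpr
    ⟨Subgroup.mem_center_iff.mpr fun t => hφ ?_, rfl⟩)
  have := key (φ t)
  rw [map_inv, mul_inv_eq_iff_eq_mul] at this
  rw [map_mul, map_mul, this]

/-! ### Minimal degrees -/

theorem minFaithfulDegree_eq_of_forall_le {G X : Type*} [Group G] {n : ℕ} (hX : Nat.card X = n)
    (hn : n ≠ 0) (f : G →* Equiv.Perm X) (hf : Function.Injective f)
    (hle : ∀ m, ∀ g : G →* Equiv.Perm (Fin m), Function.Injective g → n ≤ m) :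
    minFaithfulDegree G = n := by
  have : Finite X := Nat.finite_of_card_ne_zero (hX ▸ hn)
  have e : X ≃ Fin n := Finite.equivFinOfCardEq hX
  have hmem : n ∈ {n : ℕ | ∃ f : G →* Equiv.Perm (Fin n), Function.Injective f} :=
    ⟨(e.permCongrHom : Equiv.Perm X →* Equiv.Perm (Fin n)).comp f,
      e.permCongrHom.injective.comp hf⟩
  refine le_antisymm (Nat.sInf_le hmem) (le_csInf ⟨n, hmem⟩ ?_)
  rintro m ⟨g, hg⟩
  exact hle m g hg

theorem minFaithfulDegree_centralSquare_binaryTetrahedral :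
    minFaithfulDegree (CentralSquare binaryTetrahedral) = 24 :=
  minFaithfulDegree_eq_of_forall_le card_binaryTetrahedral (by norm_num)
    (CentralSquare.toPerm toUnits.toMonoidHom fun z hz x =>
      (Subgroup.mem_center_iff.mp hz x).symm)
    (CentralSquare.toPerm_injective toUnits.injective _) fun _ _ => le_of_injective_perm

/-! ### The reflection representation of type `F₄` -/

theorem rootReflection_apply (v x : EuclideanSpace ℝ (Fin 4)) :
    rootReflection v x = x - (2 * (inner ℝ v x / ‖v‖ ^ 2)) • v := by
  rw [rootReflection, Submodule.reflection_orthogonal_apply, Submodule.reflection_singleton_apply,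
    neg_sub, two_smul, two_mul, add_smul]
  rfl

theorem rootReflection_apply_coord (v x : EuclideanSpace ℝ (Fin 4)) (i : Fin 4) :
    rootReflection v x i = x i - 2 * ((v 0 * x 0 + v 1 * x 1 + v 2 * x 2 + v 3 * x 3) /
      (v 0 ^ 2 + v 1 ^ 2 + v 2 ^ 2 + v 3 ^ 2)) * v i := by
  rw [rootReflection_apply, EuclideanSpace.real_norm_sq_eq, PiLp.inner_apply]
  simp [Fin.sum_univ_four, mul_comm]

theorem isometry_mul_apply (f g : EuclideanSpace ℝ (Fin 4) ≃ₗᵢ[ℝ] EuclideanSpace ℝ (Fin 4))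
    (x : EuclideanSpace ℝ (Fin 4)) : (f * g) x = f (g x) := rfl

/-- The orthogonal reflection in the image of `v` is the conjugate of that in `v`. -/
theorem rootReflection_map (f : EuclideanSpace ℝ (Fin 4) ≃ₗᵢ[ℝ] EuclideanSpace ℝ (Fin 4))
    (v : EuclideanSpace ℝ (Fin 4)) : rootReflection (f v) = f * rootReflection v * f⁻¹ := by
  ext1 x
  obtain ⟨y, rfl⟩ := f.surjective x
  have : f⁻¹ (f y) = y := f.symm_apply_apply y
  rw [isometry_mul_apply, isometry_mul_apply, this, rootReflection_apply,
    rootReflection_apply]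
  simp

/-- The Cartan integers `2⟨αᵢ, αⱼ⟩ / ⟨αⱼ, αⱼ⟩` of the simple roots of type `F₄`. -/
def cartanF4 : Fin 4 → Fin 4 → ℤ :=
  ![![2, -1, 0, 0], ![-1, 2, -2, 0], ![0, -1, 2, -1], ![0, 0, -1, 2]]

/-- The action of a simple reflection on coordinates with respect to the simple roots. -/
def simpleAct (j : Fin 4) (c : Fin 4 → ℤ) : Fin 4 → ℤ := fun k =>
  if k = j then
    c k - (c 0 * cartanF4 0 j + c 1 * cartanF4 1 j + c 2 * cartanF4 2 j + c 3 * cartanF4 3 j)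
  else c k

/-- The integral combination of the simple roots with given coefficients. -/
def simpleComb (c : Fin 4 → ℤ) : EuclideanSpace ℝ (Fin 4) := ∑ k, (c k : ℝ) • simpleRootF4 k

theorem simpleComb_eq (c : Fin 4 → ℤ) : simpleComb c =
    !₂[(c 3 / 2 : ℝ), c 0 - c 3 / 2, -c 0 + c 1 - c 3 / 2, -c 1 + c 2 - c 3 / 2] := by
  ext k
  fin_cases k <;> simp [simpleComb, Fin.sum_univ_four, simpleRootF4] <;> ring

theorem simpleComb_single (k : Fin 4) : simpleComb (Pi.single k 1) = simpleRootF4 k := by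
  rw [simpleComb, Finset.sum_eq_single k]
  · simp
  · intro j _ hj
    simp [hj]
  · simp

theorem rootReflection_simpleComb (j : Fin 4) (c : Fin 4 → ℤ) :
    rootReflection (simpleRootF4 j) (simpleComb c) = simpleComb (simpleAct j c) := by
  rw [simpleComb_eq, simpleComb_eq]
  ext k
  rw [rootReflection_apply_coord]
  fin_cases j <;> fin_cases k <;> simp [simpleRootF4, simpleAct, cartanF4] <;> ring

theorem eq_sum_simpleRootF4 (x : EuclideanSpace ℝ (Fin 4)) :
    x = (3 * x 0 + x 1 + x 2 + x 3) • simpleRootF4 2 + (2 * x 0 + x 1 + x 2) • simpleRootF4 1 +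
      (x 0 + x 1) • simpleRootF4 0 + (2 * x 0) • simpleRootF4 3 := by
  ext k
  fin_cases k <;> simp [simpleRootF4] <;> ring

/-- The simple roots span, so that an isometry fixing them is the identity. -/
theorem eq_one_of_forall_simpleRootF4
    {f : EuclideanSpace ℝ (Fin 4) ≃ₗᵢ[ℝ] EuclideanSpace ℝ (Fin 4)}
    (h : ∀ i, f (simpleRootF4 i) = simpleRootF4 i) : f = 1 := by
  ext1 x
  rw [eq_sum_simpleRootF4 x]
  simp [h]

theorem pow_rootReflection_simpleComb (i j : Fin 4) (m : ℕ) (c : Fin 4 → ℤ) :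
    ((rootReflection (simpleRootF4 i) * rootReflection (simpleRootF4 j)) ^ m) (simpleComb c) =
      simpleComb ((simpleAct i ∘ simpleAct j)^[m] c) := by
  induction m generalizing c with
  | zero => rfl
  | succ m ih =>
    rw [pow_succ, isometry_mul_apply, isometry_mul_apply,
      rootReflection_simpleComb, rootReflection_simpleComb, ih, Function.iterate_succ_apply]
    rfl

/-- The Coxeter relations of type `F₄`, checked on each simple root. -/
theorem iterate_simpleAct : ∀ i j k : Fin 4,
    (simpleAct i ∘ simpleAct j)^[CoxeterMatrix.F₄ i j] (Pi.single k 1) = Pi.single k 1 := by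
  decide +kernel

theorem isLiftable_rootReflection :
    CoxeterMatrix.F₄.IsLiftable fun i => rootReflection (simpleRootF4 i) := by
  intro i j
  refine eq_one_of_forall_simpleRootF4 fun k => ?_
  rw [← simpleComb_single, pow_rootReflection_simpleComb, iterate_simpleAct]

/-- The Coxeter system of type `F₄`. -/
def coxeterF4 : CoxeterSystem CoxeterMatrix.F₄ CoxeterMatrix.F₄.Group :=
  CoxeterMatrix.F₄.toCoxeterSystem

/-- The reflection representation of the Coxeter group of type `F₄`. -/
def reflectionRep : CoxeterMatrix.F₄.Group →*
    (EuclideanSpace ℝ (Fin 4) ≃ₗᵢ[ℝ] EuclideanSpace ℝ (Fin 4)) :=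
  coxeterF4.lift ⟨_, isLiftable_rootReflection⟩

@[simp] theorem reflectionRep_simple (i : Fin 4) :
    reflectionRep (coxeterF4.simple i) = rootReflection (simpleRootF4 i) :=
  coxeterF4.lift_apply_simple isLiftable_rootReflection i

theorem reflectionRep_wordProd (ω : List (Fin 4)) (c : Fin 4 → ℤ) :
    reflectionRep (coxeterF4.wordProd ω) (simpleComb c) = simpleComb (ω.foldr simpleAct c) := by
  induction ω with
  | nil => simp
  | cons i ω ih =>
    rw [coxeterF4.wordProd_cons, map_mul, isometry_mul_apply, ih, reflectionRep_simple,
      rootReflection_simpleComb, List.foldr_cons]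

/-! ### Faithfulness of the reflection representation -/

/-- In a dihedral parabolic subgroup, an alternating word that can be prolonged by `sᵢ` to a
reduced word maps `αᵢ` to a non-negative combination of `αᵢ` and `αⱼ`. -/
theorem foldr_simpleAct_alternatingWord : ∀ i j : Fin 4, i ≠ j → ∀ n < CoxeterMatrix.F₄ i j,
    ∀ k, 0 ≤ (CoxeterSystem.alternatingWord i j n).foldr simpleAct (Pi.single i 1) k ∧
      (k ≠ i → k ≠ j →
        (CoxeterSystem.alternatingWord i j n).foldr simpleAct (Pi.single i 1) k = 0) := by
  intro i
  fin_cases i <;> decide +kernel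

/-- The non-negative integral combinations of the simple roots. -/
def positiveCone : AddSubmonoid (EuclideanSpace ℝ (Fin 4)) :=
  AddSubmonoid.closure (Set.range simpleRootF4)

theorem simpleRootF4_mem_positiveCone (i : Fin 4) : simpleRootF4 i ∈ positiveCone :=
  AddSubmonoid.subset_closure ⟨i, rfl⟩

/-- The linear form that takes the value `1` at every simple root is non-negative on the cone. -/
theorem height_nonneg {x : EuclideanSpace ℝ (Fin 4)} (hx : x ∈ positiveCone) :
    0 ≤ 8 * x 0 + 3 * x 1 + 2 * x 2 + x 3 := by
  induction hx using AddSubmonoid.closure_induction with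
  | mem x hx =>
    obtain ⟨i, rfl⟩ := hx
    fin_cases i <;> simp [simpleRootF4] <;> norm_num
  | zero => simp
  | add x y _ _ hx hy =>
    simp only [PiLp.add_apply]
    linarith

theorem neg_simpleRootF4_notMem_positiveCone (i : Fin 4) : -simpleRootF4 i ∉ positiveCone := by
  intro h
  have := height_nonneg h
  revert this
  fin_cases i <;> simp [simpleRootF4] <;> norm_num

open CoxeterSystem in
/-- An element of a Coxeter group with right descent `j` factors as `v * a`, where `a` is a
non-empty alternating word in `i, j` ending in `j`, where lengths add up, and where `v` has neither
`i` nor `j` as a right descent. -/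
theorem exists_mul_alternatingWord {B W : Type*} [Group W] {M : CoxeterMatrix B}
    (cs : CoxeterSystem M W) (i j : B) {w : W} (hw : cs.IsRightDescent w j) :
    ∃ v n, n ≠ 0 ∧ w = v * cs.wordProd (alternatingWord i j n) ∧
      cs.length w = cs.length v + n ∧ ¬ cs.IsRightDescent v i ∧ ¬ cs.IsRightDescent v j := by
  classical
  -- the factorization with the longest possible alternating word has the required property
  let P : ℕ → Prop := fun n => ∃ v, w = v * cs.wordProd (alternatingWord i j n) ∧
    cs.length w = cs.length v + n
  have hP1 : P 1 := by
    refine ⟨w * cs.simple j, ?_, ?_⟩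
    · simp [alternatingWord]
    · exact (cs.isRightDescent_iff.mp hw).symm
  have hbound : ∀ n, P n → n ≤ cs.length w := by
    rintro n ⟨v, -, h⟩
    omega
  obtain ⟨n, hPn, hn1, hmax⟩ : ∃ n, P n ∧ 1 ≤ n ∧ ¬ P (n + 1) := by
    refine ⟨Nat.findGreatest P (cs.length w), Nat.findGreatest_spec (hbound 1 hP1) hP1,
      Nat.le_findGreatest (hbound 1 hP1) hP1, fun h => ?_⟩
    have := Nat.le_findGreatest (hbound _ h) h
    omega
  obtain ⟨v, e, hl⟩ := hPn
  -- otherwise the alternating word could be made longer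
  have hlong : ¬ cs.IsRightDescent v (if Even n then j else i) := by
    intro h
    refine hmax ⟨v * cs.simple (if Even n then j else i), ?_, ?_⟩
    · rw [alternatingWord_succ', cs.wordProd_cons, ← mul_assoc, cs.simple_mul_simple_cancel_right,
        e]
    · have := cs.isRightDescent_iff.mp h
      omega
  -- otherwise the first letter of the alternating word would cancel, and `w` would be shorter
  have hshort : ¬ cs.IsRightDescent v (if Even n then i else j) := by
    intro h
    obtain ⟨m, rfl⟩ : ∃ m, n = m + 1 := ⟨n - 1, by omega⟩
    have hm : (if Even m then j else i) = if Even (m + 1) then i else j := by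
      by_cases hm : Even m <;> simp [hm, Nat.even_add_one]
    rw [alternatingWord_succ', cs.wordProd_cons, ← mul_assoc, hm] at e
    have h1 := cs.isRightDescent_iff.mp h
    have h2 := cs.length_mul_le (v * cs.simple (if Even (m + 1) then i else j))
      (cs.wordProd (alternatingWord i j m))
    have h3 := cs.length_wordProd_le (alternatingWord i j m)
    rw [length_alternatingWord] at h3
    rw [← e] at h2
    omega
  refine ⟨v, n, by omega, e, hl, ?_⟩
  by_cases hev : Even n
  · rw [if_pos hev] at hlong hshort
    exact ⟨hshort, hlong⟩
  · rw [if_neg hev] at hlong hshort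
    exact ⟨hlong, hshort⟩

theorem coxeterMatrixF4_ne_zero : ∀ i j, CoxeterMatrix.F₄ i j ≠ 0 := by
  intro i j
  fin_cases i <;> fin_cases j <;> decide

/-- If `sᵢ` is not a right descent of `w`, then `w` maps `αᵢ` to a positive root. -/
theorem reflectionRep_simpleRootF4_mem (w : CoxeterMatrix.F₄.Group) (i : Fin 4)
    (h : ¬ coxeterF4.IsRightDescent w i) :
    reflectionRep w (simpleRootF4 i) ∈ positiveCone := by
  induction hl : coxeterF4.length w using Nat.strong_induction_on generalizing w i with
  | _ l ih =>
    subst hl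
    by_cases hw : w = 1
    · subst hw
      simpa using simpleRootF4_mem_positiveCone i
    obtain ⟨j, hj⟩ := coxeterF4.exists_rightDescent_of_ne_one hw
    have hij : i ≠ j := by
      rintro rfl
      exact h hj
    obtain ⟨v, n, hn, e, hlen, hvi, hvj⟩ := exists_mul_alternatingWord coxeterF4 i j hj
    have hlt : coxeterF4.length v < coxeterF4.length w := by omega
    have hM : n < CoxeterMatrix.F₄ i j := by
      by_contra! hM
      -- lengths add up in `w * sᵢ = v * a * sᵢ`, so the alternating word for `a * sᵢ` is reduced
      refine coxeterF4.not_isReduced_alternatingWord j i (m := n + 1)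
        (coxeterMatrixF4_ne_zero j i) (by rw [CoxeterMatrix.symmetric]; omega) ?_
      have h1 := coxeterF4.not_isRightDescent_iff.mp h
      have h2 := coxeterF4.length_wordProd_le (CoxeterSystem.alternatingWord j i (n + 1))
      have h3 := coxeterF4.length_mul_le v
        (coxeterF4.wordProd (CoxeterSystem.alternatingWord j i (n + 1)))
      have h4 : v * coxeterF4.wordProd (CoxeterSystem.alternatingWord j i (n + 1)) =
          w * coxeterF4.simple i := by
        rw [CoxeterSystem.alternatingWord_succ, coxeterF4.wordProd_concat, ← mul_assoc, ← e]
      rw [h4] at h3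
      rw [CoxeterSystem.IsReduced]
      rw [CoxeterSystem.length_alternatingWord] at h2 ⊢
      omega
    have key := foldr_simpleAct_alternatingWord i j hij n hM
    rw [e, map_mul, isometry_mul_apply, ← simpleComb_single, reflectionRep_wordProd]
    set c := (CoxeterSystem.alternatingWord i j n).foldr simpleAct (Pi.single i 1)
    have hc : simpleComb c = (c i).toNat • simpleRootF4 i + (c j).toNat • simpleRootF4 j := by
      have hcast (k) : ((c k).toNat : ℝ) = c k := by
        exact_mod_cast Int.toNat_of_nonneg (key k).1
      rw [← Nat.cast_smul_eq_nsmul ℝ, ← Nat.cast_smul_eq_nsmul ℝ, hcast, hcast, simpleComb,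
        ← Finset.sum_pair (f := fun k => (c k : ℝ) • simpleRootF4 k) hij]
      refine (Finset.sum_subset (Finset.subset_univ _) fun k _ hk => ?_).symm
      simp only [Finset.mem_insert, Finset.mem_singleton, not_or] at hk
      rw [(key k).2 hk.1 hk.2, Int.cast_zero, zero_smul]
    rw [hc, map_add, map_nsmul, map_nsmul]
    exact add_mem (nsmul_mem (ih _ hlt v i hvi rfl) _) (nsmul_mem (ih _ hlt v j hvj rfl) _)

theorem reflectionRep_injective : Function.Injective reflectionRep := by
  rw [injective_iff_map_eq_one]
  intro w hw
  by_contra hne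
  obtain ⟨i, hi⟩ := coxeterF4.exists_rightDescent_of_ne_one hne
  have h := reflectionRep_simpleRootF4_mem (w * coxeterF4.simple i) i
    ((coxeterF4.isRightDescent_iff_not_isRightDescent_mul).mp hi)
  rw [map_mul, hw, one_mul, reflectionRep_simple, rootReflection,
    Submodule.reflection_orthogonalComplement_singleton_eq_neg] at h
  exact neg_simpleRootF4_notMem_positiveCone i h

/-! ### The roots of type `F₄` -/

/-- The vector of Euclidean 4-space whose coordinates are half of those of `q`. -/
def halfVec (q : ℍ[ℤ]) : EuclideanSpace ℝ (Fin 4) := Quaternion.linearIsometryEquivTuple (halve q)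

theorem halfVec_intQuat (a b c d : ℤ) :
    halfVec (intQuat a b c d) = !₂[(a / 2 : ℝ), b / 2, c / 2, d / 2] := rfl

theorem halfVec_injective : Function.Injective halfVec :=
  Quaternion.linearIsometryEquivTuple.injective.comp halve_injective

theorem norm_sq_halfVec (q : ℍ[ℤ]) :
    ‖halfVec q‖ ^ 2 = ((q.re ^ 2 + q.imI ^ 2 + q.imJ ^ 2 + q.imK ^ 2 : ℤ) : ℝ) / 4 := by
  rw [halfVec, LinearIsometryEquiv.norm_map, norm_sq_halve]

theorem exists_halfVec_iff {v : EuclideanSpace ℝ (Fin 4)} :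
    ((∀ i, ∃ n : ℤ, v i = n) ∨ (∀ i, ∃ n : ℤ, v i = n + 1 / 2)) ↔
      ∃ q : ℍ[ℤ], (2 ∣ q.imI - q.re ∧ 2 ∣ q.imJ - q.re ∧ 2 ∣ q.imK - q.re) ∧ halfVec q = v := by
  constructor
  · rintro (h | h) <;> choose n hn using h
    · refine ⟨intQuat (2 * n 0) (2 * n 1) (2 * n 2) (2 * n 3), ?_, ?_⟩
      · refine ⟨?_, ?_, ?_⟩ <;> exact (Dvd.intro _ rfl).sub (Dvd.intro _ rfl)
      · rw [halfVec_intQuat]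
        ext i
        fin_cases i <;> simp [hn]
    · refine ⟨intQuat (2 * n 0 + 1) (2 * n 1 + 1) (2 * n 2 + 1) (2 * n 3 + 1), ?_, ?_⟩
      · simp only [intQuat_re, intQuat_imI, intQuat_imJ, intQuat_imK]
        omega
      · rw [halfVec_intQuat]
        ext i
        fin_cases i <;> simp [hn] <;> ring
  · rintro ⟨q, ⟨⟨b', hb⟩, ⟨c', hc⟩, ⟨d', hd⟩⟩, rfl⟩
    obtain ⟨a, b, c, d, rfl⟩ := exists_eq_intQuat q
    simp only [intQuat_re, intQuat_imI, intQuat_imJ, intQuat_imK] at hb hc hd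
    obtain rfl : b = a + 2 * b' := by omega
    obtain rfl : c = a + 2 * c' := by omega
    obtain rfl : d = a + 2 * d' := by omega
    rw [halfVec_intQuat]
    rcases Int.even_or_odd' a with ⟨m, rfl | rfl⟩
    · left
      intro i
      refine ⟨![m, m + b', m + c', m + d'] i, ?_⟩
      fin_cases i <;> simp <;> ring
    · right
      intro i
      refine ⟨![m, m + b', m + c', m + d'] i, ?_⟩
      fin_cases i <;> simp <;> ring

theorem mem_rootsF4OfSqLength_iff {m : ℤ} (hm : m = 1 ∨ m = 2) {v : EuclideanSpace ℝ (Fin 4)} :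
    v ∈ rootsF4OfSqLength m ↔ ∃ q ∈ doubledShell (4 * m), halfVec q = v := by
  have hm8 : 4 * m ≤ 8 := by omega
  have hnorm (q : ℍ[ℤ]) : ‖halfVec q‖ ^ 2 = m ↔
      q.re ^ 2 + q.imI ^ 2 + q.imJ ^ 2 + q.imK ^ 2 = 4 * m := by
    rw [norm_sq_halfVec, div_eq_iff four_ne_zero, mul_comm (m : ℝ)]
    exact_mod_cast Iff.rfl
  constructor
  · rintro ⟨⟨-, h⟩, hl⟩
    obtain ⟨q, hq, rfl⟩ := exists_halfVec_iff.mp h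
    exact ⟨q, (mem_doubledShell hm8).mpr ⟨hq, (hnorm q).mp hl⟩, rfl⟩
  · rintro ⟨q, hq, rfl⟩
    obtain ⟨h1, h2⟩ := (mem_doubledShell hm8).mp hq
    have h3 := (hnorm q).mpr h2
    refine ⟨⟨?_, exists_halfVec_iff.mpr ⟨q, h1, rfl⟩⟩, h3⟩
    rw [h3]
    exact_mod_cast hm

theorem ncard_rootsF4OfSqLength {m : ℤ} (hm : m = 1 ∨ m = 2) :
    (rootsF4OfSqLength m).ncard = 24 := by
  have h : rootsF4OfSqLength m = halfVec '' (doubledShell (4 * m) : Set ℍ[ℤ]) :=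
    Set.ext fun v => mem_rootsF4OfSqLength_iff hm
  rw [h, Set.ncard_image_of_injective _ halfVec_injective, Set.ncard_coe_finset]
  rcases hm with rfl | rfl
  · exact card_doubledShell_four
  · exact card_doubledShell_eight

theorem rootReflection_mem_roots (i : Fin 4) {l : ℝ} {v : EuclideanSpace ℝ (Fin 4)}
    (hv : v ∈ rootsF4OfSqLength l) :
    rootReflection (simpleRootF4 i) v ∈ rootsF4OfSqLength l := by
  obtain ⟨⟨h1, h2⟩, h3⟩ := hv
  rw [rootsF4OfSqLength, rootsF4, Set.mem_ofPred_eq, Set.mem_ofPred_eq, LinearIsometryEquiv.norm_map]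
  refine ⟨⟨h1, ?_⟩, h3⟩
  rw [exists_halfVec_iff] at h2 ⊢
  obtain ⟨q, ⟨⟨b', hb⟩, ⟨c', hc⟩, ⟨d', hd⟩⟩, rfl⟩ := h2
  obtain ⟨a, b, c, d, rfl⟩ := exists_eq_intQuat q
  simp only [intQuat_re, intQuat_imI, intQuat_imJ, intQuat_imK] at hb hc hd
  obtain rfl : b = a + 2 * b' := by omega
  obtain rfl : c = a + 2 * c' := by omega
  obtain rfl : d = a + 2 * d' := by omega
  -- row `i` of `p` holds the doubled coordinates of the image under the `i`-th reflection
  let p : Fin 4 → Fin 4 → ℤ := ![![a, a + 2 * c', a + 2 * b', a + 2 * d'],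
    ![a, a + 2 * b', a + 2 * d', a + 2 * c'], ![a, a + 2 * b', a + 2 * c', -(a + 2 * d')],
    ![2 * a + b' + c' + d', b' - c' - d', c' - b' - d', d' - b' - c']]
  refine ⟨intQuat (p i 0) (p i 1) (p i 2) (p i 3), ?_, ?_⟩
  · fin_cases i <;> simp [p] <;> omega
  · rw [halfVec_intQuat, halfVec_intQuat]
    ext k
    rw [rootReflection_apply_coord]
    fin_cases i <;> fin_cases k <;> simp [p, simpleRootF4] <;> ring

theorem reflectionRep_mem_roots (w : CoxeterMatrix.F₄.Group) {l : ℝ}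
    {v : EuclideanSpace ℝ (Fin 4)} (hv : v ∈ rootsF4OfSqLength l) :
    reflectionRep w v ∈ rootsF4OfSqLength l := by
  induction w using coxeterF4.simple_induction_left with
  | one => simpa using hv
  | mul_simple_left w i ih =>
    rw [map_mul, isometry_mul_apply, reflectionRep_simple]
    exact rootReflection_mem_roots i ih

/-- The roots of either length span Euclidean 4-space. -/
theorem eq_one_of_forall_roots {m : ℤ} (hm : m = 1 ∨ m = 2)
    {f : EuclideanSpace ℝ (Fin 4) ≃ₗᵢ[ℝ] EuclideanSpace ℝ (Fin 4)}
    (h : ∀ v ∈ rootsF4OfSqLength m, f v = v) : f = 1 := by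
  have h' (q : ℍ[ℤ]) (hq : q ∈ doubledShell (4 * m)) : f (halfVec q) = halfVec q :=
    h _ ((mem_rootsF4OfSqLength_iff hm).mpr ⟨q, hq, rfl⟩)
  ext1 x
  rcases hm with rfl | rfl
  · have e : x = x 0 • halfVec (intQuat 2 0 0 0) + x 1 • halfVec (intQuat 0 2 0 0) +
        x 2 • halfVec (intQuat 0 0 2 0) + x 3 • halfVec (intQuat 0 0 0 2) := by
      simp only [halfVec_intQuat]
      ext k
      fin_cases k <;> simp
    rw [e]
    simp [h' (intQuat 2 0 0 0) (by decide +kernel), h' (intQuat 0 2 0 0) (by decide +kernel),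
      h' (intQuat 0 0 2 0) (by decide +kernel), h' (intQuat 0 0 0 2) (by decide +kernel)]
  · have e : x = ((x 0 + x 1) / 2) • halfVec (intQuat 2 2 0 0) +
        ((x 0 - x 1) / 2) • halfVec (intQuat 2 (-2) 0 0) +
        ((x 2 + x 3) / 2) • halfVec (intQuat 0 0 2 2) + ((x 2 - x 3) / 2) • halfVec (intQuat 0 0 2 (-2)) := by
      simp only [halfVec_intQuat]
      ext k
      fin_cases k <;> simp <;> ring
    rw [e]
    simp [h' (intQuat 2 2 0 0) (by decide +kernel), h' (intQuat 2 (-2) 0 0) (by decide +kernel),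
      h' (intQuat 0 0 2 2) (by decide +kernel), h' (intQuat 0 0 2 (-2)) (by decide +kernel)]

theorem eq_one_of_reflectionRep_fixes_roots {m : ℤ} (hm : m = 1 ∨ m = 2)
    {w : CoxeterMatrix.F₄.Group} (h : ∀ v ∈ rootsF4OfSqLength m, reflectionRep w v = v) : w = 1 :=
  reflectionRep_injective ((eq_one_of_forall_roots hm h).trans (map_one _).symm)

/-- The permutation action of `W(F₄)` on the short roots. -/
def shortRootPerm : CoxeterMatrix.F₄.Group →* Equiv.Perm (rootsF4OfSqLength (1 : ℤ)) :=
  MonoidHom.toHomPerm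
    { toFun := fun w v => ⟨reflectionRep w v, reflectionRep_mem_roots w v.2⟩
      map_one' := by
        funext v
        exact Subtype.ext (DFunLike.congr_fun (map_one reflectionRep) v.1)
      map_mul' := fun w w' => by
        funext v
        exact Subtype.ext (DFunLike.congr_fun (map_mul reflectionRep w w') v.1) }

theorem shortRootPerm_injective : Function.Injective shortRootPerm := by
  rw [injective_iff_map_eq_one]
  intro w hw
  refine eq_one_of_reflectionRep_fixes_roots (Or.inl rfl) fun v hv => ?_
  exact congrArg (fun e : Equiv.Perm (rootsF4OfSqLength (1 : ℤ)) =>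
    (e ⟨v, hv⟩ : EuclideanSpace ℝ (Fin 4))) hw

/-! ### The central square inside the reflection group -/

theorem rootReflection_mem_range {u v w : EuclideanSpace ℝ (Fin 4)}
    (hv : rootReflection v ∈ reflectionRep.range) (hu : rootReflection u ∈ reflectionRep.range)
    (e : rootReflection v u = w) : rootReflection w ∈ reflectionRep.range := by
  rw [← e, rootReflection_map]
  exact mul_mem (mul_mem hv hu) (inv_mem hv)

theorem rootReflection_simple_mem_range (i : Fin 4) :
    rootReflection (simpleRootF4 i) ∈ reflectionRep.range :=
  ⟨_, reflectionRep_simple i⟩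

/-- Reflections in further roots, obtained by reflecting roots in one another. -/
theorem rootReflection_mem_range_of_roots :
    rootReflection !₂[1, 0, 0, 0] ∈ reflectionRep.range ∧
    rootReflection !₂[0, 1, 0, 0] ∈ reflectionRep.range ∧
    rootReflection !₂[1, -1, 0, 0] ∈ reflectionRep.range ∧
    rootReflection !₂[1 / 2, 1 / 2, 1 / 2, 1 / 2] ∈ reflectionRep.range := by
  have h0 := rootReflection_simple_mem_range 0
  have h1 := rootReflection_simple_mem_range 1
  have h2 := rootReflection_simple_mem_range 2
  have h3 := rootReflection_simple_mem_range 3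
  have e2 : rootReflection !₂[0, 0, 1, 0] ∈ reflectionRep.range := by
    refine rootReflection_mem_range h1 h2 ?_
    ext k
    rw [rootReflection_apply_coord]
    fin_cases k <;> simp [simpleRootF4] <;> norm_num
  have e1 : rootReflection !₂[0, 1, 0, 0] ∈ reflectionRep.range := by
    refine rootReflection_mem_range h0 e2 ?_
    ext k
    rw [rootReflection_apply_coord]
    fin_cases k <;> simp [simpleRootF4] <;> norm_num
  have a1 : rootReflection !₂[1 / 2, -1 / 2, -1 / 2, 1 / 2] ∈ reflectionRep.range := by
    refine rootReflection_mem_range h2 h3 ?_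
    ext k
    rw [rootReflection_apply_coord]
    fin_cases k <;> simp [simpleRootF4]
    norm_num
  have a2 : rootReflection !₂[1 / 2, -1 / 2, 1 / 2, 1 / 2] ∈ reflectionRep.range := by
    refine rootReflection_mem_range e2 a1 ?_
    ext k
    rw [rootReflection_apply_coord]
    fin_cases k <;> simp
    norm_num
  have a3 : rootReflection !₂[1 / 2, 1 / 2, 1 / 2, 1 / 2] ∈ reflectionRep.range := by
    refine rootReflection_mem_range e1 a2 ?_
    ext k
    rw [rootReflection_apply_coord]
    fin_cases k <;> simp
    norm_num
  have e0 : rootReflection !₂[1, 0, 0, 0] ∈ reflectionRep.range := by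
    refine rootReflection_mem_range a3 h3 ?_
    ext k
    rw [rootReflection_apply_coord]
    fin_cases k <;> simp [simpleRootF4] <;> norm_num
  have b1 : rootReflection !₂[0, 1, 1, 0] ∈ reflectionRep.range := by
    refine rootReflection_mem_range e2 h0 ?_
    ext k
    rw [rootReflection_apply_coord]
    fin_cases k <;> simp [simpleRootF4]
    norm_num
  have b2 : rootReflection !₂[1, 0, 0, -1] ∈ reflectionRep.range := by
    refine rootReflection_mem_range h3 b1 ?_
    ext k
    rw [rootReflection_apply_coord]
    fin_cases k <;> simp [simpleRootF4] <;> norm_num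
  have b3 : rootReflection !₂[1, 0, -1, 0] ∈ reflectionRep.range := by
    refine rootReflection_mem_range h1 b2 ?_
    ext k
    rw [rootReflection_apply_coord]
    fin_cases k <;> simp [simpleRootF4] <;> norm_num
  have b4 : rootReflection !₂[1, -1, 0, 0] ∈ reflectionRep.range := by
    refine rootReflection_mem_range h0 b3 ?_
    ext k
    rw [rootReflection_apply_coord]
    fin_cases k <;> simp [simpleRootF4] <;> norm_num
  exact ⟨e0, e1, b4, a3⟩

/-- The inclusion of the binary tetrahedral group in the units of the quaternions. -/
def binaryTetrahedralToUnits : binaryTetrahedral →* ℍ[ℝ]ˣ :=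
  Unitary.toUnits.comp binaryTetrahedral.subtype

theorem binaryTetrahedralToUnits_injective : Function.Injective binaryTetrahedralToUnits :=
  Unitary.toUnits_injective.comp Subtype.coe_injective

theorem coe_ofDoubled (q : ℍ[ℤ]) (hq : q ∈ doubledShell 4) :
    (binaryTetrahedralToUnits (ofDoubled q hq) : ℍ[ℝ]) = halve q := rfl

/-- The unit quaternion `i`. -/
def unitI : binaryTetrahedral := ofDoubled (intQuat 0 2 0 0) (by decide +kernel)

/-- The unit quaternion `k`. -/
def unitK : binaryTetrahedral := ofDoubled (intQuat 0 0 0 2) (by decide +kernel)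

/-- The unit quaternion `(-1 + i + j + k) / 2` of order three. -/
def unitT : binaryTetrahedral := ofDoubled (intQuat (-1) 1 1 1) (by decide +kernel)

/-- A quaternion that commutes with `i` and `k` is real. -/
theorem center_binaryTetrahedral_commute :
    ∀ z ∈ Subgroup.center binaryTetrahedral, ∀ x : ℍ[ℝ],
      binaryTetrahedralToUnits z * x = x * binaryTetrahedralToUnits z := by
  intro z hz x
  have hi := congrArg (fun g => (binaryTetrahedralToUnits g : ℍ[ℝ]))
    (Subgroup.mem_center_iff.mp hz unitI)
  have hk := congrArg (fun g => (binaryTetrahedralToUnits g : ℍ[ℝ]))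
    (Subgroup.mem_center_iff.mp hz unitK)
  simp only [map_mul, Units.val_mul, unitI, unitK, coe_ofDoubled] at hi hk
  generalize (binaryTetrahedralToUnits z : ℍ[ℝ]) = y at *
  rw [Quaternion.ext_iff] at hi hk
  simp at hi hk
  have h1 : y.imI = 0 := by linarith [hk.2]
  have h2 : y.imJ = 0 := by linarith [hi.2, hi.1]
  have h3 : y.imK = 0 := by linarith [hi.2, hi.1]
  ext <;> simp [h1, h2, h3] <;> ring

/-- The action of `T ∘ T` on the quaternions by left and right multiplication. -/
def quaternionPerm : CentralSquare binaryTetrahedral →* Equiv.Perm ℍ[ℝ] :=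
  CentralSquare.toPerm binaryTetrahedralToUnits center_binaryTetrahedral_commute

theorem quaternionPerm_injective : Function.Injective quaternionPerm :=
  CentralSquare.toPerm_injective binaryTetrahedralToUnits_injective _

/-- The reflection representation, transported to the quaternions. -/
def reflectionPerm : CoxeterMatrix.F₄.Group →* Equiv.Perm ℍ[ℝ] where
  toFun w := (Quaternion.linearIsometryEquivTuple.toEquiv.trans (reflectionRep w).toEquiv).trans
    Quaternion.linearIsometryEquivTuple.symm.toEquiv
  map_one' := by
    rw [map_one]
    exact Equiv.ext fun x => Quaternion.linearIsometryEquivTuple.symm_apply_apply x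
  map_mul' w w' := by
    refine Equiv.ext fun x => Quaternion.linearIsometryEquivTuple.injective ?_
    rw [map_mul]
    simp only [Equiv.Perm.mul_apply, Equiv.trans_apply]
    simp [isometry_mul_apply, -Quaternion.linearIsometryEquivTuple_apply,
      -Quaternion.linearIsometryEquivTuple_symm_apply]

theorem reflectionPerm_apply (w : CoxeterMatrix.F₄.Group) (x : ℍ[ℝ]) :
    Quaternion.linearIsometryEquivTuple (reflectionPerm w x) =
      reflectionRep w (Quaternion.linearIsometryEquivTuple x) :=
  Quaternion.linearIsometryEquivTuple.apply_symm_apply _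

theorem reflectionPerm_injective : Function.Injective reflectionPerm := by
  intro w w' h
  apply reflectionRep_injective
  ext1 x
  obtain ⟨y, rfl⟩ := Quaternion.linearIsometryEquivTuple.surjective x
  rw [← reflectionPerm_apply, ← reflectionPerm_apply, h]

theorem quaternionPerm_mem_range {g h : binaryTetrahedral}
    {f : EuclideanSpace ℝ (Fin 4) ≃ₗᵢ[ℝ] EuclideanSpace ℝ (Fin 4)} (hf : f ∈ reflectionRep.range)
    (e : ∀ x : ℍ[ℝ], Quaternion.linearIsometryEquivTuple
      (binaryTetrahedralToUnits g * x * star (binaryTetrahedralToUnits h : ℍ[ℝ])) =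
        f (Quaternion.linearIsometryEquivTuple x)) :
    quaternionPerm (QuotientGroup.mk (g, h)) ∈ reflectionPerm.range := by
  obtain ⟨w, rfl⟩ := hf
  refine ⟨w, Equiv.ext fun x => ?_⟩
  apply Quaternion.linearIsometryEquivTuple.injective
  rw [reflectionPerm_apply, ← e]
  rfl

/-- Every doubled unit Hurwitz quaternion is, up to left multiplication by `i ^ a * k ^ b`, the
double of `1`, of `unitT` or of the inverse of `unitT`. -/
theorem doubledShell_four_eq_products : ∀ q ∈ doubledShell 4, ∃ a < 4, ∃ b < 2,
    q = intQuat 0 1 0 0 ^ a * (intQuat 0 0 0 1 ^ b * 2) ∨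
    q = intQuat 0 1 0 0 ^ a * (intQuat 0 0 0 1 ^ b * intQuat (-1) 1 1 1) ∨
    q = intQuat 0 1 0 0 ^ a * (intQuat 0 0 0 1 ^ b * star (intQuat (-1) 1 1 1)) := by
  decide +kernel

theorem halve_pow_mul (p q : ℍ[ℤ]) (n : ℕ) :
    halve (p ^ n * q) = halve (p + p) ^ n * halve q := by
  induction n with
  | zero => simp
  | succ n ih =>
    rw [pow_succ', pow_succ', mul_assoc, mul_assoc, ← ih]
    generalize p ^ n * q = r
    ext <;> simp <;> ring

/-- The binary tetrahedral group is the union of the cosets of the quaternion group `⟨i, k⟩`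
represented by the powers of `unitT`. -/
theorem eq_top_of_generators {S : Subgroup binaryTetrahedral} (hi : unitI ∈ S) (ht : unitT ∈ S) :
    S = ⊤ := by
  -- conjugation by `unitT` permutes `i, j, k` cyclically
  have hk : unitK ∈ S := by
    have e : unitT * unitI * unitT⁻¹ = unitK := by
      rw [mul_inv_eq_iff_eq_mul]
      apply binaryTetrahedralToUnits_injective
      ext1
      simp only [map_mul, Units.val_mul, unitI, unitK, unitT, coe_ofDoubled]
      ext <;> simp <;> ring
    rw [← e]
    exact mul_mem (mul_mem ht hi) (inv_mem ht)
  rw [Subgroup.eq_top_iff']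
  intro g
  obtain ⟨q, hq, rfl⟩ := exists_eq_ofDoubled g
  obtain ⟨a, -, b, -, h⟩ := doubledShell_four_eq_products q hq
  have key (c : binaryTetrahedral) (hc : c ∈ S) (z : ℍ[ℤ])
      (hz : (binaryTetrahedralToUnits c : ℍ[ℝ]) = halve z)
      (hq' : q = intQuat 0 1 0 0 ^ a * (intQuat 0 0 0 1 ^ b * z)) : ofDoubled q hq ∈ S := by
    have e : ofDoubled q hq = unitI ^ a * (unitK ^ b * c) := by
      apply binaryTetrahedralToUnits_injective
      ext1
      rw [coe_ofDoubled, hq', halve_pow_mul, halve_pow_mul, map_mul, map_mul, map_pow, map_pow]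
      simp only [Units.val_mul, Units.val_pow_eq_pow_val, hz]
      rfl
    rw [e]
    exact mul_mem (pow_mem hi a) (mul_mem (pow_mem hk b) hc)
  rcases h with h | h | h
  · refine key 1 S.one_mem 2 ?_ h
    rw [map_one, Units.val_one, ← one_add_one_eq_two]
    ext <;> simp
  · exact key unitT ht _ rfl h
  · exact key unitT⁻¹ (inv_mem ht) _ (halve_star _).symm h

theorem tuple_mk (x : ℍ[ℝ]) : Quaternion.linearIsometryEquivTuple x =
    !₂[x.re, x.imI, x.imJ, x.imK] := rfl

/-- Left and right multiplication by `i` and by `unitT` are products of rotations in two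
orthogonal planes, each rotation being the product of the reflections in two roots.  The left and
the right multiplication differ by the sense of rotation in the plane that contains `1`. -/
theorem quaternionPerm_generators_mem_range :
    quaternionPerm (QuotientGroup.mk (unitI, 1)) ∈ reflectionPerm.range ∧
    quaternionPerm (QuotientGroup.mk (1, unitI)) ∈ reflectionPerm.range ∧
    quaternionPerm (QuotientGroup.mk (unitT, 1)) ∈ reflectionPerm.range ∧
    quaternionPerm (QuotientGroup.mk (1, unitT)) ∈ reflectionPerm.range := by
  obtain ⟨h1, h2, h3, h4⟩ := rootReflection_mem_range_of_roots
  have s0 := rootReflection_simple_mem_range 0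
  have s1 := rootReflection_simple_mem_range 1
  have s2 := rootReflection_simple_mem_range 2
  refine ⟨quaternionPerm_mem_range (mul_mem (mul_mem h3 h2) (mul_mem s1 s2)) fun x => ?_,
    quaternionPerm_mem_range (mul_mem (mul_mem h2 h3) (mul_mem s1 s2)) fun x => ?_,
    quaternionPerm_mem_range (mul_mem (mul_mem h4 h1) (mul_mem s0 s1)) fun x => ?_,
    quaternionPerm_mem_range (mul_mem (mul_mem h1 h4) (mul_mem s0 s1)) fun x => ?_⟩ <;>
  · simp only [isometry_mul_apply, map_one, unitI, unitT, coe_ofDoubled, Units.val_one, star_one,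
      one_mul, mul_one, tuple_mk]
    ext k
    simp only [rootReflection_apply_coord]
    fin_cases k <;> simp [simpleRootF4] <;> ring

theorem quaternionPerm_range_le : quaternionPerm.range ≤ reflectionPerm.range := by
  obtain ⟨h1, h2, h3, h4⟩ := quaternionPerm_generators_mem_range
  let π := quaternionPerm.comp (QuotientGroup.mk' (centralDiagonal binaryTetrahedral))
  have hl : reflectionPerm.range.comap (π.comp (MonoidHom.inl _ _)) = ⊤ :=
    eq_top_of_generators h1 h3
  have hr : reflectionPerm.range.comap (π.comp (MonoidHom.inr _ _)) = ⊤ :=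
    eq_top_of_generators h2 h4
  rintro _ ⟨x, rfl⟩
  obtain ⟨⟨g, h⟩, rfl⟩ := QuotientGroup.mk_surjective x
  have hg : π (g, 1) ∈ reflectionPerm.range := (Subgroup.eq_top_iff' _).mp hl g
  have hh : π (1, h) ∈ reflectionPerm.range := (Subgroup.eq_top_iff' _).mp hr h
  have := mul_mem hg hh
  rwa [← map_mul, Prod.mk_mul_mk, mul_one, one_mul] at this

/-- `T ∘ T` embeds in `W(F₄)`. -/
theorem exists_injective_centralSquare_to_coxeterF4 :
    ∃ f : CentralSquare binaryTetrahedral →* CoxeterMatrix.F₄.Group, Function.Injective f := by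
  refine ⟨(MonoidHom.ofInjective reflectionPerm_injective).symm.toMonoidHom.comp
    ((Subgroup.inclusion quaternionPerm_range_le).comp quaternionPerm.rangeRestrict), ?_⟩
  refine (MonoidHom.ofInjective reflectionPerm_injective).symm.injective.comp
    ((Subgroup.inclusion_injective quaternionPerm_range_le).comp ?_)
  exact (MonoidHom.rangeRestrict_injective_iff).mpr quaternionPerm_injective

theorem minFaithfulDegree_coxeterF4 : minFaithfulDegree CoxeterMatrix.F₄.Group = 24 := by
  refine minFaithfulDegree_eq_of_forall_le (ncard_rootsF4OfSqLength (Or.inl rfl)) (by norm_num)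
    shortRootPerm shortRootPerm_injective fun m g hg => ?_
  obtain ⟨f, hf⟩ := exists_injective_centralSquare_to_coxeterF4
  exact le_of_injective_perm (f := g.comp f) (hg.comp hf)

end

theorem mainTheorem2 :
    -- both minimal degrees are `24`; `CoxeterMatrix.F₄.Group` is the Coxeter group `W(F₄)`
    minFaithfulDegree (CentralSquare binaryTetrahedral) = 24 ∧
    minFaithfulDegree CoxeterMatrix.F₄.Group = 24 ∧
    -- `T ∘ T` has a unique minimal normal subgroup, and that subgroup is cyclic of order 2
    (∃ N : Subgroup (CentralSquare binaryTetrahedral),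
      (∀ M : Subgroup (CentralSquare binaryTetrahedral), IsMinimalNormal M ↔ M = N) ∧
      Nonempty (N ≃* Multiplicative (ZMod 2))) ∧
    -- every minimal faithful permutation representation of `T ∘ T` is transitive
    (∀ f : CentralSquare binaryTetrahedral →*
        Equiv.Perm (Fin (minFaithfulDegree (CentralSquare binaryTetrahedral))),
      Function.Injective f → ∀ x y, ∃ g, f g x = y) ∧
    -- every core-free subgroup of `T ∘ T` has index at least `24`
    (∀ L : Subgroup (CentralSquare binaryTetrahedral), L.normalCore = ⊥ → 24 ≤ L.index) ∧
    -- `W(F₄)` acts as a reflection group, faithfully on the `24` roots of either length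
    (∃ ρ : CoxeterMatrix.F₄.Group →*
        (EuclideanSpace ℝ (Fin 4) ≃ₗᵢ[ℝ] EuclideanSpace ℝ (Fin 4)),
      (∀ i, ρ (CoxeterMatrix.F₄.simple i) = rootReflection (simpleRootF4 i)) ∧
      ∀ l : ℝ, l = 1 ∨ l = 2 →
        (rootsF4OfSqLength l).ncard = 24 ∧
        (∀ w, ∀ v ∈ rootsF4OfSqLength l, ρ w v ∈ rootsF4OfSqLength l) ∧
        (∀ w, (∀ v ∈ rootsF4OfSqLength l, ρ w v = v) → w = 1)) := by
  refine ⟨minFaithfulDegree_centralSquare_binaryTetrahedral, minFaithfulDegree_coxeterF4,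
    ⟨Subgroup.zpowers centralInvolution, isMinimalNormal_iff, ?_⟩, ?_,
    fun L => index_ge_of_normalCore_eq_bot, reflectionRep, reflectionRep_simple, ?_⟩
  · have : Fact (Nat.Prime 2) := ⟨Nat.prime_two⟩
    exact ⟨mulEquivOfPrimeCardEq (p := 2)
      (by rw [Nat.card_zpowers, orderOf_centralInvolution]) (by simp)⟩
  · rw [minFaithfulDegree_centralSquare_binaryTetrahedral]
    exact fun f hf => transitive_of_injective_perm hf
  · intro l hl
    obtain ⟨m, hm, rfl⟩ : ∃ m : ℤ, (m = 1 ∨ m = 2) ∧ l = m := by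
      rcases hl with rfl | rfl
      · exact ⟨1, Or.inl rfl, by simp⟩
      · exact ⟨2, Or.inr rfl, by simp⟩
    exact ⟨ncard_rootsF4OfSqLength hm, fun w _ => reflectionRep_mem_roots w,
      fun _ => eq_one_of_reflectionRep_fixes_roots hm⟩
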